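/- Let $(\bar M,J,g)$ be a Kähler manifold, i.e. $J$ is a smooth almost complex structure with $J^2=-\mathrm{id}$, $g$ is a Riemannian metric with $g(JX,JY)=g(X,Y)$, and $J$ is parallel for the Levi-Civita connection of $g$. Let $(M_T,g_T)$, $(M_\varphi,g_\varphi)$, $(M_\perp,g_\perp)$ be Riemannian manifolds with $M_T$ connected, $M_\varphi$ non-empty of positive dimension and $M_\perp$ non-empty, and let $f,\sigma:M_T\to(0,\infty)$ be smooth. Suppose that the biwarped product $M_T\times_f M_\varphi\times_\sigma M_\perp$, i.e. the product manifold $M_T\times M_\varphi\times M_\perp$ with the metric $$\pi_T^*g_T+(f\circ\pi_T)^2\,\pi_\varphi^*g_\varphi+(\sigma\circ\pi_T)^2\,\pi_\perp^*g_\perp ,$$ is isometrically immersed in $\bar M$ so that, writing $W$ for the tangent space of a factor (a leaf $M_T\times\{(y,z)\}$, $\{x\}\times M_\varphi\times\{z\}$ or $\{(x,y)\}\times M_\perp$) at a point, seen in the tangent space of $\bar M$: * $M_T$ is holomorphic: $J(W)\subseteq W$ for all leaves of $M_T$ and all their points; * $M_\varphi$ is proper slant: for a constant angle $\varphi\in(0,\pi/2)$,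 for all leaves of $M_\varphi$, all their points and all non-zero $V\in W$, the angle between $JV$ and $W$ equals $\varphi$; * $M_\perp$ is totally real: $J(W)\perp W$ for all leaves of $M_\perp$ and all their points. Then the warping function $f$ of the slant fibre is constant. That is, whatever $\sigma$ is, there is no submanifold $M_T\times_f M_\varphi\times_\sigma M_\perp$ of this type in a Kähler manifold with $f$ non-constant; in particular there is none for which both warping functions are non-constant. -/

import Mathlib

open Bundle
open scoped Manifold ContDiff

noncomputable section

/-! ### Kähler manifolds -/

section Kahler

variable {E : Type*} [NormedAddCommGroup E] [NormedSpace ℝ E] [FiniteDimensional ℝ E]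
  {M : Type*} [TopologicalSpace M] [ChartedSpace E M] [IsManifold 𝓘(ℝ, E) ∞ M]
  [RiemannianBundle (fun x : M ↦ TangentSpace 𝓘(ℝ, E) x)]
  [IsContMDiffRiemannianBundle 𝓘(ℝ, E) ∞ E (fun x : M ↦ TangentSpace 𝓘(ℝ, E) x)]

/-- A connection `D` on the tangent bundle is the Levi-Civita connection of the Riemannian metric:
it is compatible with the metric, `v ⟨Y, Z⟩ = ⟨∇_v Y, Z⟩ + ⟨Y, ∇_v Z⟩`, and torsion free
(recall that `D Y x v` is `(∇_v Y)(x)`). -/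
def IsLeviCivita
    (D : CovariantDerivative 𝓘(ℝ, E) E (fun x : M ↦ TangentSpace 𝓘(ℝ, E) x)) : Prop :=
  (∀ (x : M) (Y Z : ∀ y : M, TangentSpace 𝓘(ℝ, E) y),
    MDifferentiableAt 𝓘(ℝ, E) (𝓘(ℝ, E).prod 𝓘(ℝ, E))
      (fun y ↦ (TotalSpace.mk' E y (Y y) : TangentBundle 𝓘(ℝ, E) M)) x →
    MDifferentiableAt 𝓘(ℝ, E) (𝓘(ℝ, E).prod 𝓘(ℝ, E))
      (fun y ↦ (TotalSpace.mk' E y (Z y) : TangentBundle 𝓘(ℝ, E) M)) x →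
    ∀ v : TangentSpace 𝓘(ℝ, E) x,
      mvfderiv 𝓘(ℝ, E) (fun y ↦ (inner ℝ (Y y) (Z y) : ℝ)) x v
        = inner ℝ (D Y x v) (Z x) + inner ℝ (Y x) (D Z x v)) ∧
  D.torsion = 0

/-- `(M, J, g)` is a Kähler manifold, where `g` is the Riemannian metric of `M`: `J` is a smooth
almost complex structure, `g` is Hermitian with respect to `J`, and `J` is parallel with respect
to the Levi-Civita connection, that is `∇ (J Y) = J (∇ Y)` for all vector fields `Y`. -/
structure IsKahler
    (J : ∀ x : M, TangentSpace 𝓘(ℝ, E) x →L[ℝ] TangentSpace 𝓘(ℝ, E) x) : Prop where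
  contMDiff : ContMDiff 𝓘(ℝ, E) (𝓘(ℝ, E).prod 𝓘(ℝ, E →L[ℝ] E)) ∞
    (fun x ↦ TotalSpace.mk' (E →L[ℝ] E)
      (E := fun x : M ↦ TangentSpace 𝓘(ℝ, E) x →L[ℝ] TangentSpace 𝓘(ℝ, E) x) x (J x))
  sq_eq_neg : ∀ (x : M) (v : TangentSpace 𝓘(ℝ, E) x), J x (J x v) = -v
  hermitian : ∀ (x : M) (v w : TangentSpace 𝓘(ℝ, E) x),
    inner ℝ (J x v) (J x w) = inner ℝ v w
  parallel : ∃ D : CovariantDerivative 𝓘(ℝ, E) E (fun x : M ↦ TangentSpace 𝓘(ℝ, E) x),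
    IsLeviCivita D ∧
      ∀ (x : M) (Y : ∀ y : M, TangentSpace 𝓘(ℝ, E) y),
        MDifferentiableAt 𝓘(ℝ, E) (𝓘(ℝ, E).prod 𝓘(ℝ, E))
          (fun y ↦ (TotalSpace.mk' E y (Y y) : TangentBundle 𝓘(ℝ, E) M)) x →
        ∀ v : TangentSpace 𝓘(ℝ, E) x, D (fun y ↦ J y (Y y)) x v = J x (D Y x v)

end Kahler

/-! ### The position of a submanifold relative to `J` -/

/-- The angle between a vector and a subspace: the angle between the vector and its orthogonal
projection to the subspace (it is `π / 2` when this projection is zero). -/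
def angleToSubspace {V : Type*} [NormedAddCommGroup V] [InnerProductSpace ℝ V]
    (u : V) (W : Submodule ℝ V) [W.HasOrthogonalProjection] : ℝ :=
  InnerProductGeometry.angle u (W.starProjection u)

section Submanifolds

variable {E F : Type*} [NormedAddCommGroup E] [NormedSpace ℝ E]
  [NormedAddCommGroup F] [NormedSpace ℝ F] [FiniteDimensional ℝ F]
  {M : Type*} [TopologicalSpace M] [ChartedSpace E M]
  {N : Type*} [TopologicalSpace N] [ChartedSpace F N]

/-- The tangent space at `p` of the submanifold immersed by `i : N → M`, as a subspace of the
tangent space of `M` at `i p`. -/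
def tangentImage (i : N → M) (p : N) : Submodule ℝ (TangentSpace 𝓘(ℝ, E) (i p)) :=
  (mfderiv 𝓘(ℝ, F) 𝓘(ℝ, E) i p).range

instance (i : N → M) (p : N) :
    FiniteDimensional ℝ (tangentImage (E := E) (F := F) i p) := by
  have : FiniteDimensional ℝ (TangentSpace 𝓘(ℝ, F) p) :=
    inferInstanceAs (FiniteDimensional ℝ F)
  exact inferInstanceAs (FiniteDimensional ℝ
    (LinearMap.range (mfderiv 𝓘(ℝ, F) 𝓘(ℝ, E) i p).toLinearMap))

/-- The submanifold is holomorphic: `J (T_p N) ⊆ T_p N` for all `p`. -/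
def IsHolomorphicSubmanifold
    (J : ∀ x : M, TangentSpace 𝓘(ℝ, E) x →L[ℝ] TangentSpace 𝓘(ℝ, E) x) (i : N → M) : Prop :=
  ∀ (p : N), ∀ v ∈ tangentImage (E := E) (F := F) i p,
    J (i p) v ∈ tangentImage (E := E) (F := F) i p

variable [RiemannianBundle (fun x : M ↦ TangentSpace 𝓘(ℝ, E) x)]

/-- The submanifold is totally real: `J (T_p N)` is orthogonal to `T_p N` for all `p`. -/
def IsTotallyRealSubmanifold
    (J : ∀ x : M, TangentSpace 𝓘(ℝ, E) x →L[ℝ] TangentSpace 𝓘(ℝ, E) x) (i : N → M) : Prop :=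
  ∀ (p : N), ∀ v ∈ tangentImage (E := E) (F := F) i p,
    ∀ w ∈ tangentImage (E := E) (F := F) i p, inner ℝ (J (i p) v) w = 0

/-- The submanifold is slant with slant angle `θ`: for all `p` and all nonzero `v` in `T_p N`, the
(Wirtinger) angle between `J v` and the subspace `T_p N` is `θ`. -/
def IsSlantSubmanifold
    (J : ∀ x : M, TangentSpace 𝓘(ℝ, E) x →L[ℝ] TangentSpace 𝓘(ℝ, E) x) (i : N → M)
    (θ : ℝ) : Prop :=
  ∀ (p : N), ∀ v ∈ tangentImage (E := E) (F := F) i p, v ≠ 0 →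
    angleToSubspace (J (i p) v) (tangentImage (E := E) (F := F) i p) = θ

end Submanifolds

/-! ### Biwarped products -/

section Biwarped

variable {E E₀ E₁ E₂ : Type*} [NormedAddCommGroup E] [NormedSpace ℝ E]
  [NormedAddCommGroup E₀] [NormedSpace ℝ E₀] [NormedAddCommGroup E₁] [NormedSpace ℝ E₁]
  [NormedAddCommGroup E₂] [NormedSpace ℝ E₂]
  {M : Type*} [TopologicalSpace M] [ChartedSpace E M]
  {M₀ : Type*} [TopologicalSpace M₀] [ChartedSpace E₀ M₀]
  {M₁ : Type*} [TopologicalSpace M₁] [ChartedSpace E₁ M₁]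
  {M₂ : Type*} [TopologicalSpace M₂] [ChartedSpace E₂ M₂]

/-- The model of the product manifold `M₀ × M₁ × M₂`. -/
abbrev prodModel (E₀ E₁ E₂ : Type*) [NormedAddCommGroup E₀] [NormedSpace ℝ E₀]
    [NormedAddCommGroup E₁] [NormedSpace ℝ E₁] [NormedAddCommGroup E₂] [NormedSpace ℝ E₂] :
    ModelWithCorners ℝ (E₀ × E₁ × E₂) (ModelProd E₀ (ModelProd E₁ E₂)) :=
  𝓘(ℝ, E₀).prod (𝓘(ℝ, E₁).prod 𝓘(ℝ, E₂))

variable [RiemannianBundle (fun x : M ↦ TangentSpace 𝓘(ℝ, E) x)]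
  [RiemannianBundle (fun x : M₀ ↦ TangentSpace 𝓘(ℝ, E₀) x)]
  [RiemannianBundle (fun x : M₁ ↦ TangentSpace 𝓘(ℝ, E₁) x)]
  [RiemannianBundle (fun x : M₂ ↦ TangentSpace 𝓘(ℝ, E₂) x)]

/-- The biwarped product metric `π₀^* g₀ + (f₁ ∘ π₀)^2 π₁^* g₁ + (f₂ ∘ π₀)^2 π₂^* g₂` on the
product manifold `M₀ × M₁ × M₂`. -/
def biwarpedMetric (f₁ f₂ : M₀ → ℝ) (p : M₀ × M₁ × M₂)
    (u v : TangentSpace (prodModel E₀ E₁ E₂) p) : ℝ :=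
  inner ℝ (mfderiv (prodModel E₀ E₁ E₂) 𝓘(ℝ, E₀) (fun q : M₀ × M₁ × M₂ ↦ q.1) p u)
      (mfderiv (prodModel E₀ E₁ E₂) 𝓘(ℝ, E₀) (fun q : M₀ × M₁ × M₂ ↦ q.1) p v)
    + f₁ p.1 ^ 2 *
      inner ℝ (mfderiv (prodModel E₀ E₁ E₂) 𝓘(ℝ, E₁) (fun q : M₀ × M₁ × M₂ ↦ q.2.1) p u)
        (mfderiv (prodModel E₀ E₁ E₂) 𝓘(ℝ, E₁) (fun q : M₀ × M₁ × M₂ ↦ q.2.1) p v)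
    + f₂ p.1 ^ 2 *
      inner ℝ (mfderiv (prodModel E₀ E₁ E₂) 𝓘(ℝ, E₂) (fun q : M₀ × M₁ × M₂ ↦ q.2.2) p u)
        (mfderiv (prodModel E₀ E₁ E₂) 𝓘(ℝ, E₂) (fun q : M₀ × M₁ × M₂ ↦ q.2.2) p v)

/-- `i` is an isometric immersion into `M` of the biwarped product `M₀ ×_{f₁} M₁ ×_{f₂} M₂`,
where the warping functions are smooth and positive. (The differential of such a map is
injective because the biwarped product metric is positive definite.) -/
structure IsBiwarpedProductSubmanifold (f₁ f₂ : M₀ → ℝ) (i : M₀ × M₁ × M₂ → M) : Prop where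
  contMDiff₁ : ContMDiff 𝓘(ℝ, E₀) 𝓘(ℝ, ℝ) ∞ f₁
  contMDiff₂ : ContMDiff 𝓘(ℝ, E₀) 𝓘(ℝ, ℝ) ∞ f₂
  pos₁ : ∀ x, 0 < f₁ x
  pos₂ : ∀ x, 0 < f₂ x
  contMDiff : ContMDiff (prodModel E₀ E₁ E₂) 𝓘(ℝ, E) ∞ i
  isometric : ∀ (p : M₀ × M₁ × M₂) (u v : TangentSpace (prodModel E₀ E₁ E₂) p),
    inner ℝ (mfderiv (prodModel E₀ E₁ E₂) 𝓘(ℝ, E) i p u)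
        (mfderiv (prodModel E₀ E₁ E₂) 𝓘(ℝ, E) i p v)
      = biwarpedMetric f₁ f₂ p u v

end Biwarped

end

/-! The Kähler form $\omega(Y,Z)=\langle JY,Z\rangle$ is closed, since $\nabla J=0$ and $\nabla$ is
metric and torsion free (`IsKahler.closed`). Pull it back to a slice $M_T\times
M_\varphi\times\{z\}$. As $JTM_T\subseteq TM_T$ and the factors are orthogonal, $\omega(X,V)=0$ for
$X$ tangent to $M_T$ and $V$ to $M_\varphi$. For commuting fields, $d\omega(X,V,W)=0$ then reduces
to $X\,\omega(V,W)=0$, so $\omega$ on the slant fibre does not depend on $x\in M_T$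
(`IsKahler.hasMFDerivAt_inner_deriv₂`, `eq_of_hasMFDerivAt_zero`).

On the other hand $\omega(V,W)=f(x)^2\langle U_x,W\rangle$, where $U_x$ represents the tangential
part of $JV$. The slant condition gives $\|U_x\|=\cos\varphi\,\|V\|$ for every $x$. Hence
$f(x)^2U_x$ is independent of $x$, and taking norms, with $\cos\varphi>0$, so is $f(x)^2$. -/

set_option linter.unusedSectionVars false

noncomputable section

open VectorField Topology

/-! ### Closedness of the Kähler form, intrinsically and in a chart. -/

section KahlerForm

variable {E : Type*} [NormedAddCommGroup E] [NormedSpace ℝ E]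
  {M : Type*} [TopologicalSpace M] [ChartedSpace E M] [IsManifold 𝓘(ℝ, E) ∞ M]

/-- The constant vector field `a` on a vector space. -/
def constField (a u : E) : TangentSpace 𝓘(ℝ, E) u := a

/-- The vector field that is constant, equal to `a`, in the chart at `x₀`. -/
def coordField (x₀ : M) (a : E) (x : M) : TangentSpace 𝓘(ℝ, E) x :=
  mpullback 𝓘(ℝ, E) 𝓘(ℝ, E) (extChartAt 𝓘(ℝ, E) x₀) (constField a) x

theorem mdifferentiableAt_constField (a u : E) :
    MDifferentiableAt 𝓘(ℝ, E) (𝓘(ℝ, E).prod 𝓘(ℝ, E))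
      (fun u : E ↦ (TotalSpace.mk' E u (constField a u) : TangentBundle 𝓘(ℝ, E) E)) u := by
  rw [mdifferentiableAt_section]
  simpa [constField] using! mdifferentiableAt_const

/-- The differential at `x` of the chart at `x₀`. -/
def chartDeriv (x₀ x : M) : TangentSpace 𝓘(ℝ, E) x →L[ℝ] E :=
  mfderiv 𝓘(ℝ, E) 𝓘(ℝ, E) (extChartAt 𝓘(ℝ, E) x₀) x

theorem coordField_chartDeriv {x₀ x : M} (hx : x ∈ (extChartAt 𝓘(ℝ, E) x₀).source)
    (v : TangentSpace 𝓘(ℝ, E) x) : coordField x₀ (chartDeriv x₀ x v) x = v :=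
  (isInvertible_mfderiv_extChartAt hx).inverse_apply_eq.2 rfl

theorem chartDeriv_coordField {x₀ x : M} (hx : x ∈ (extChartAt 𝓘(ℝ, E) x₀).source) (a : E) :
    chartDeriv x₀ x (coordField x₀ a x) = a :=
  ((isInvertible_mfderiv_extChartAt hx).inverse_apply_eq.1 rfl).symm

variable [FiniteDimensional ℝ E]

theorem mdifferentiableAt_coordField {x₀ x : M} (hx : x ∈ (extChartAt 𝓘(ℝ, E) x₀).source) (a : E) :
    MDifferentiableAt 𝓘(ℝ, E) (𝓘(ℝ, E).prod 𝓘(ℝ, E))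
      (fun y ↦ (TotalSpace.mk' E y (coordField x₀ a y) : TangentBundle 𝓘(ℝ, E) M)) x := by
  refine MDifferentiableAt.mpullback_vectorField (n := ∞) (mdifferentiableAt_constField a _)
    (contMDiffAt_extChartAt' (by simpa using hx)) (isInvertible_mfderiv_extChartAt hx) ?_
  exact ENat.LEInfty.out

/-- Pullback by a local diffeomorphism preserves brackets, and constant fields commute. This turns
vanishing torsion into symmetry of $\nabla$ on coordinate fields. -/
theorem mlieBracket_coordField {x₀ x : M} (hx : x ∈ (extChartAt 𝓘(ℝ, E) x₀).source) (a b : E) :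
    mlieBracket 𝓘(ℝ, E) (coordField x₀ a) (coordField x₀ b) x = 0 := by
  have : IsManifold 𝓘(ℝ, E) (minSmoothness ℝ 2) M := by
    rw [minSmoothness_of_isRCLikeNormedField]; infer_instance
  have := mpullback_mlieBracket (n := ∞) (I := 𝓘(ℝ, E)) (I' := 𝓘(ℝ, E))
     (f := extChartAt 𝓘(ℝ, E) x₀) (x₀ := x) (mdifferentiableAt_constField a _)
     (mdifferentiableAt_constField b _)
     (contMDiffAt_extChartAt' (by simpa using hx))
     (by rw [minSmoothness_of_isRCLikeNormedField]; exact ENat.LEInfty.out)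
  have hbr : mlieBracket 𝓘(ℝ, E) (constField a) (constField b) (extChartAt 𝓘(ℝ, E) x₀ x) = 0 := by
    rw [← mlieBracketWithin_univ, mlieBracketWithin_eq_lieBracketWithin]
    change fderivWithin ℝ (fun _ ↦ b) Set.univ _ a
      - fderivWithin ℝ (fun _ ↦ a) Set.univ _ b = (0 : E)
    simp
  exact this.symm.trans ((congrArg _ hbr).trans (ContinuousLinearMap.map_zero _))

variable [RiemannianBundle (fun x : M ↦ TangentSpace 𝓘(ℝ, E) x)]
  {J : ∀ x : M, TangentSpace 𝓘(ℝ, E) x →L[ℝ] TangentSpace 𝓘(ℝ, E) x}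

theorem IsKahler.inner_J_left (hJ : IsKahler J) (x : M) (v w : TangentSpace 𝓘(ℝ, E) x) :
    inner ℝ (J x v) w = - inner ℝ v (J x w) := by
  rw [← hJ.hermitian, hJ.sq_eq_neg, inner_neg_left]

theorem IsKahler.inner_J_swap (hJ : IsKahler J) (x : M) (v w : TangentSpace 𝓘(ℝ, E) x) :
    inner ℝ (J x v) w = - inner ℝ (J x w) v := by
  rw [hJ.inner_J_left, real_inner_comm]

theorem IsKahler.mdifferentiableAt_J (hJ : IsKahler J) {x : M}
    {Y : ∀ y : M, TangentSpace 𝓘(ℝ, E) y}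
    (hY : MDifferentiableAt 𝓘(ℝ, E) (𝓘(ℝ, E).prod 𝓘(ℝ, E))
      (fun y ↦ (TotalSpace.mk' E y (Y y) : TangentBundle 𝓘(ℝ, E) M)) x) :
    MDifferentiableAt 𝓘(ℝ, E) (𝓘(ℝ, E).prod 𝓘(ℝ, E))
      (fun y ↦ (TotalSpace.mk' E y (J y (Y y)) : TangentBundle 𝓘(ℝ, E) M)) x :=
  MDifferentiableAt.clm_bundle_apply (hJ.contMDiff.mdifferentiableAt (by simp)) hY

/-- The Kähler form `⟨J Y, Z⟩` is closed, expressed through commuting vector fields. -/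
theorem IsKahler.closed (hJ : IsKahler J) {x₀ x : M} (hx : x ∈ (extChartAt 𝓘(ℝ, E) x₀).source)
    (a b c : E) :
    mvfderiv 𝓘(ℝ, E) (fun y ↦ (inner ℝ (J y (coordField x₀ b y)) (coordField x₀ c y) : ℝ)) x
        (coordField x₀ a x)
      + mvfderiv 𝓘(ℝ, E) (fun y ↦ (inner ℝ (J y (coordField x₀ c y)) (coordField x₀ a y) : ℝ)) x
        (coordField x₀ b x)
      + mvfderiv 𝓘(ℝ, E) (fun y ↦ (inner ℝ (J y (coordField x₀ a y)) (coordField x₀ b y) : ℝ)) x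
        (coordField x₀ c x) = 0 := by
  obtain ⟨D, ⟨hmet, htor⟩, hpar⟩ := hJ.parallel
  have hd := fun a ↦ mdifferentiableAt_coordField hx a
  have hsym : ∀ a b, D (coordField x₀ b) x (coordField x₀ a x)
      = D (coordField x₀ a) x (coordField x₀ b x) := fun a b ↦ by
    have := (CovariantDerivative.torsion_eq_zero_iff D).1 htor (hd a) (hd b)
    rw [mlieBracket_coordField hx] at this
    exact sub_eq_zero.1 this
  -- Metric compatibility and $\nabla J=0$; skewness of $J$ moves it onto the differentiated field
  -- in the second term. In the cyclic sum the six terms then cancel in pairs by `hsym`.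
  have key : ∀ a b c,
      mvfderiv 𝓘(ℝ, E) (fun y ↦ (inner ℝ (J y (coordField x₀ b y)) (coordField x₀ c y) : ℝ)) x
        (coordField x₀ a x) = inner ℝ (J x (D (coordField x₀ b) x (coordField x₀ a x)))
          (coordField x₀ c x) - inner ℝ (J x (D (coordField x₀ c) x (coordField x₀ a x)))
          (coordField x₀ b x) := fun a b c ↦ by
    rw [hmet x _ _ (hJ.mdifferentiableAt_J (hd b)) (hd c), hpar x _ (hd b),
      hJ.inner_J_swap x (coordField x₀ b x), sub_eq_add_neg]
  rw [key, key, key, hsym a b, hsym b c, hsym a c]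
  ring

/-- The Kähler form in the coordinates of the chart at `x₀`. -/
def kahlerFormInChart (J : ∀ x : M, TangentSpace 𝓘(ℝ, E) x →L[ℝ] TangentSpace 𝓘(ℝ, E) x)
    (x₀ : M) (u : E) : E →L[ℝ] E →L[ℝ] ℝ :=
  let x := (extChartAt 𝓘(ℝ, E) x₀).symm u
  let Φ : E →L[ℝ] TangentSpace 𝓘(ℝ, E) x :=
    (mfderiv 𝓘(ℝ, E) 𝓘(ℝ, E) (extChartAt 𝓘(ℝ, E) x₀) x).inverse
  (innerSL ℝ (E := TangentSpace 𝓘(ℝ, E) x)).bilinearComp (J x ∘L Φ) Φ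

theorem kahlerFormInChart_apply (x₀ : M) (u a b : E) :
    kahlerFormInChart J x₀ u a b
      = inner ℝ (J ((extChartAt 𝓘(ℝ, E) x₀).symm u)
          (coordField x₀ a ((extChartAt 𝓘(ℝ, E) x₀).symm u)))
        (coordField x₀ b ((extChartAt 𝓘(ℝ, E) x₀).symm u)) := rfl

/-- No chart condition on `u` is needed: skewness of $J$ is pointwise algebra. -/
theorem IsKahler.kahlerFormInChart_swap (hJ : IsKahler J) (x₀ : M) (u a b : E) :
    kahlerFormInChart J x₀ u a b = - kahlerFormInChart J x₀ u b a :=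
  hJ.inner_J_swap _ _ _

theorem kahlerFormInChart_extChartAt {x₀ x : M} (hx : x ∈ (extChartAt 𝓘(ℝ, E) x₀).source)
    (v w : TangentSpace 𝓘(ℝ, E) x) :
    kahlerFormInChart J x₀ (extChartAt 𝓘(ℝ, E) x₀ x) (chartDeriv x₀ x v) (chartDeriv x₀ x w)
      = inner ℝ (J x v) w := by
  rw [kahlerFormInChart_apply, (extChartAt 𝓘(ℝ, E) x₀).left_inv hx, coordField_chartDeriv hx,
    coordField_chartDeriv hx]

variable [IsContMDiffRiemannianBundle 𝓘(ℝ, E) ∞ E (fun x : M ↦ TangentSpace 𝓘(ℝ, E) x)]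

theorem IsKahler.mdifferentiableAt_inner_coordField (hJ : IsKahler J) {x₀ x : M}
    (hx : x ∈ (extChartAt 𝓘(ℝ, E) x₀).source) (a b : E) :
    MDifferentiableAt 𝓘(ℝ, E) 𝓘(ℝ, ℝ)
      (fun y ↦ (inner ℝ (J y (coordField x₀ a y)) (coordField x₀ b y) : ℝ)) x :=
  MDifferentiableAt.inner_bundle (F := E) (E := fun x : M ↦ TangentSpace 𝓘(ℝ, E) x)
    (b := fun y : M ↦ y) (v := fun y ↦ J y (coordField x₀ a y)) (w := coordField x₀ b)
    (hJ.mdifferentiableAt_J (mdifferentiableAt_coordField hx a))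
    (mdifferentiableAt_coordField hx b)

theorem IsKahler.differentiableAt_kahlerFormInChart_apply (hJ : IsKahler J) {x₀ x : M}
    (hx : x ∈ (extChartAt 𝓘(ℝ, E) x₀).source) (a b : E) :
    DifferentiableAt ℝ (fun u ↦ kahlerFormInChart J x₀ u a b) (extChartAt 𝓘(ℝ, E) x₀ x) := by
  rw [← mdifferentiableAt_iff_differentiableAt]
  have h₁ : MDifferentiableAt 𝓘(ℝ, E) 𝓘(ℝ, E) (extChartAt 𝓘(ℝ, E) x₀).symm
      (extChartAt 𝓘(ℝ, E) x₀ x) :=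
    ((contMDiffOn_extChartAt_symm (n := ∞) x₀).contMDiffAt
      (extChartAt_target_mem_nhds' ((extChartAt 𝓘(ℝ, E) x₀).map_source hx))).mdifferentiableAt
      (by simp)
  have h₂ := hJ.mdifferentiableAt_inner_coordField hx a b
  exact MDifferentiableAt.comp_of_eq _ h₂ h₁ ((extChartAt 𝓘(ℝ, E) x₀).left_inv hx)

/-- In finite dimension, evaluation on a basis identifies `V →L[ℝ] W` with a finite power of `W`. -/
theorem differentiableAt_clm_of_apply {D V W : Type*} [NormedAddCommGroup D] [NormedSpace ℝ D]
    [NormedAddCommGroup V] [NormedSpace ℝ V] [FiniteDimensional ℝ V] [NormedAddCommGroup W]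
    [NormedSpace ℝ W] {f : D → V →L[ℝ] W} {x : D}
    (h : ∀ v, DifferentiableAt ℝ (fun y ↦ f y v) x) : DifferentiableAt ℝ f x := by
  let e₁ := ContinuousLinearEquiv.ofFinrankEq (𝕜 := ℝ) (E := V)
    (Module.finrank_fin_fun ℝ (n := Module.finrank ℝ V)).symm
  let e₂ := (e₁.arrowCongr (1 : W ≃L[ℝ] W)).trans
    (ContinuousLinearEquiv.piRing (Fin (Module.finrank ℝ V)))
  rw [← Function.id_comp f, ← e₂.symm_comp_self]
  exact e₂.symm.differentiableAt.comp x (differentiableAt_pi.2 fun i ↦ h _)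

theorem IsKahler.differentiableAt_kahlerFormInChart (hJ : IsKahler J) {x₀ x : M}
    (hx : x ∈ (extChartAt 𝓘(ℝ, E) x₀).source) :
    DifferentiableAt ℝ (kahlerFormInChart J x₀) (extChartAt 𝓘(ℝ, E) x₀ x) :=
  differentiableAt_clm_of_apply fun a ↦ differentiableAt_clm_of_apply fun b ↦
    hJ.differentiableAt_kahlerFormInChart_apply hx a b

/-- Chain rule: the chart's differential sends the coordinate field of `a` to `a`. This carries
`IsKahler.closed` over to ordinary derivatives on `E`. -/
theorem IsKahler.fderiv_kahlerFormInChart (hJ : IsKahler J) {x₀ x : M}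
    (hx : x ∈ (extChartAt 𝓘(ℝ, E) x₀).source) (a b c : E) :
    fderiv ℝ (kahlerFormInChart J x₀) (extChartAt 𝓘(ℝ, E) x₀ x) a b c
      = mvfderiv 𝓘(ℝ, E) (fun y ↦ (inner ℝ (J y (coordField x₀ b y)) (coordField x₀ c y) : ℝ)) x
        (coordField x₀ a x) := by
  have hd := hJ.differentiableAt_kahlerFormInChart hx
  have h₁ : fderiv ℝ (kahlerFormInChart J x₀) (extChartAt 𝓘(ℝ, E) x₀ x) a b c
      = fderiv ℝ (fun u ↦ kahlerFormInChart J x₀ u b c) (extChartAt 𝓘(ℝ, E) x₀ x) a := by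
    have h := ((hd.hasFDerivAt.clm_apply (hasFDerivAt_const b _)).clm_apply
      (hasFDerivAt_const c _)).fderiv
    rw [h]
    simp
  have h₂ : (fun y ↦ (inner ℝ (J y (coordField x₀ b y)) (coordField x₀ c y) : ℝ)) =ᶠ[𝓝 x]
      (fun u ↦ kahlerFormInChart J x₀ u b c) ∘ extChartAt 𝓘(ℝ, E) x₀ := by
    filter_upwards [(isOpen_extChartAt_source x₀).mem_nhds hx] with y hy
    simp only [Function.comp, kahlerFormInChart_apply]
    rw [(extChartAt 𝓘(ℝ, E) x₀).left_inv hy]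
  have h₃ := hJ.differentiableAt_kahlerFormInChart_apply hx b c
  have h₄ : mfderiv 𝓘(ℝ, E) 𝓘(ℝ, E) (extChartAt 𝓘(ℝ, E) x₀) x (coordField x₀ a x) = a :=
    chartDeriv_coordField hx a
  rw [h₁, mvfderiv, h₂.mfderiv_eq, mfderiv_comp x h₃.mdifferentiableAt
    (mdifferentiableAt_extChartAt (by simpa using hx))]
  change _ = mfderiv 𝓘(ℝ, E) 𝓘(ℝ, ℝ) (fun u ↦ kahlerFormInChart J x₀ u b c)
    (extChartAt 𝓘(ℝ, E) x₀ x) (mfderiv 𝓘(ℝ, E) 𝓘(ℝ, E) (extChartAt 𝓘(ℝ, E) x₀) x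
      (coordField x₀ a x))
  rw [h₄, mfderiv_eq_fderiv]
  rfl

/-- The Kähler form is closed: its exterior derivative vanishes in a chart. -/
theorem IsKahler.closed_kahlerFormInChart (hJ : IsKahler J) {x₀ x : M}
    (hx : x ∈ (extChartAt 𝓘(ℝ, E) x₀).source) (a b c : E) :
    fderiv ℝ (kahlerFormInChart J x₀) (extChartAt 𝓘(ℝ, E) x₀ x) a b c
      + fderiv ℝ (kahlerFormInChart J x₀) (extChartAt 𝓘(ℝ, E) x₀ x) b c a
      + fderiv ℝ (kahlerFormInChart J x₀) (extChartAt 𝓘(ℝ, E) x₀ x) c a b = 0 := by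
  simp only [hJ.fderiv_kahlerFormInChart hx]
  exact hJ.closed hx a b c

end KahlerForm

/-! ### Pullback of closed two-forms between vector spaces. -/

section Pullback

variable {Q V : Type*} [NormedAddCommGroup Q] [NormedSpace ℝ Q]
  [NormedAddCommGroup V] [NormedSpace ℝ V]

set_option synthInstance.maxHeartbeats 200000 in
/-- The derivative of the pullback by `G` of a bilinear form, evaluated on constant vectors. -/
theorem hasFDerivAt_pullback {Ω : V → V →L[ℝ] V →L[ℝ] ℝ} {G : Q → V} {q : Q}
    (hΩ : DifferentiableAt ℝ Ω (G q)) (hG : ContDiffAt ℝ 2 G q) (β γ : Q) :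
    DifferentiableAt ℝ (fun p ↦ Ω (G p) (fderiv ℝ G p β) (fderiv ℝ G p γ)) q ∧
    ∀ α, fderiv ℝ (fun p ↦ Ω (G p) (fderiv ℝ G p β) (fderiv ℝ G p γ)) q α
      = fderiv ℝ Ω (G q) (fderiv ℝ G q α) (fderiv ℝ G q β) (fderiv ℝ G q γ)
        + Ω (G q) (fderiv ℝ (fderiv ℝ G) q α β) (fderiv ℝ G q γ)
        + Ω (G q) (fderiv ℝ G q β) (fderiv ℝ (fderiv ℝ G) q α γ) := by
  have h₁ : HasFDerivAt (fun p ↦ Ω (G p)) ((fderiv ℝ Ω (G q)).comp (fderiv ℝ G q)) q :=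
    HasFDerivAt.comp (g := Ω) (g' := fderiv ℝ Ω (G q)) q hΩ.hasFDerivAt
      (hG.differentiableAt (by simp)).hasFDerivAt
  have h₂ : HasFDerivAt (fderiv ℝ G) (fderiv ℝ (fderiv ℝ G) q) q :=
    ((hG.fderiv_right (m := 1) (by norm_num)).differentiableAt (by simp)).hasFDerivAt
  have h := (h₁.clm_apply (h₂.clm_apply (hasFDerivAt_const β q))).clm_apply
    (h₂.clm_apply (hasFDerivAt_const γ q))
  refine ⟨h.differentiableAt, fun α ↦ ?_⟩
  have h' := h.fderiv
  rw [h']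
  simp
  ring

set_option synthInstance.maxHeartbeats 200000 in
/-- The pullback of a closed two-form is closed. -/
theorem pullback_closed {Ω : V → V →L[ℝ] V →L[ℝ] ℝ} {G : Q → V} {q : Q}
    (hΩ : DifferentiableAt ℝ Ω (G q)) (hG : ContDiffAt ℝ 2 G q)
    (hswap : ∀ a b, Ω (G q) a b = - Ω (G q) b a)
    (hclosed : ∀ a b c, fderiv ℝ Ω (G q) a b c + fderiv ℝ Ω (G q) b c a
      + fderiv ℝ Ω (G q) c a b = 0) (α β γ : Q) :
    fderiv ℝ (fun p ↦ Ω (G p) (fderiv ℝ G p β) (fderiv ℝ G p γ)) q α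
      + fderiv ℝ (fun p ↦ Ω (G p) (fderiv ℝ G p γ) (fderiv ℝ G p α)) q β
      + fderiv ℝ (fun p ↦ Ω (G p) (fderiv ℝ G p α) (fderiv ℝ G p β)) q γ = 0 := by
  have hsymm : IsSymmSndFDerivAt ℝ G q :=
    hG.isSymmSndFDerivAt (by rw [minSmoothness_of_isRCLikeNormedField])
  -- The six terms with second derivatives of `G` cancel in pairs: its symmetry matches them and
  -- skewness of `Ω` gives opposite signs.
  rw [(hasFDerivAt_pullback hΩ hG β γ).2, (hasFDerivAt_pullback hΩ hG γ α).2,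
    (hasFDerivAt_pullback hΩ hG α β).2, hsymm.eq α β, hsymm.eq β γ, hsymm.eq γ α,
    hswap _ (fderiv ℝ (fderiv ℝ G) q α γ), hswap _ (fderiv ℝ (fderiv ℝ G) q β α),
    hswap _ (fderiv ℝ (fderiv ℝ G) q γ β)]
  linear_combination hclosed (fderiv ℝ G q α) (fderiv ℝ G q β) (fderiv ℝ G q γ)

end Pullback

/-! ### Vanishing differential on a connected manifold. -/

section Constant

variable {F : Type*} [NormedAddCommGroup F] [NormedSpace ℝ F]
  {N : Type*} [TopologicalSpace N] [ChartedSpace F N] [IsManifold 𝓘(ℝ, F) ∞ N]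

theorem mdifferentiableAt_extChartAt_symm {x₀ : N} {u : F}
    (hu : u ∈ (extChartAt 𝓘(ℝ, F) x₀).target) :
    MDifferentiableAt 𝓘(ℝ, F) 𝓘(ℝ, F) (extChartAt 𝓘(ℝ, F) x₀).symm u :=
  ((contMDiffOn_extChartAt_symm (n := ∞) x₀).contMDiffAt
    ((isOpen_extChartAt_target x₀).mem_nhds hu)).mdifferentiableAt (by simp)

/-- A function on a connected manifold with vanishing differential is constant. -/
theorem eq_of_hasMFDerivAt_zero [PreconnectedSpace N] {h : N → ℝ}
    (hh : ∀ x, HasMFDerivAt 𝓘(ℝ, F) 𝓘(ℝ, ℝ) h x 0) (x y : N) : h x = h y := by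
  refine IsLocallyConstant.apply_eq_of_isPreconnected (f := h) ?_ isPreconnected_univ
    (Set.mem_univ _) (Set.mem_univ _)
  rw [IsLocallyConstant.iff_eventually_eq]
  intro x₀
  set e := extChartAt 𝓘(ℝ, F) x₀
  have hd : ∀ u ∈ e.target, HasFDerivAt (h ∘ e.symm) (0 : F →L[ℝ] ℝ) u := fun u hu ↦ by
    have := (hh (e.symm u)).comp u (mdifferentiableAt_extChartAt_symm hu).hasMFDerivAt
    exact (hasMFDerivAt_iff_hasFDerivAt.1 this).congr_fderiv
      (ContinuousLinearMap.zero_comp _)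
  -- A ball in the chart's target is convex, so a zero derivative there forces constancy.
  obtain ⟨r, hr, hball⟩ := Metric.isOpen_iff.1 (isOpen_extChartAt_target x₀) (e x₀)
    (mem_extChartAt_target x₀)
  filter_upwards [(isOpen_extChartAt_source (I := 𝓘(ℝ, F)) x₀).mem_nhds
    (mem_extChartAt_source (I := 𝓘(ℝ, F)) x₀),
    (continuousAt_extChartAt (I := 𝓘(ℝ, F)) x₀).preimage_mem_nhds
      (Metric.ball_mem_nhds (e x₀) hr)] with y hy hyr
  have := (convex_ball (e x₀) r).is_const_of_fderivWithin_eq_zero (𝕜 := ℝ) (f := h ∘ e.symm)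
    (fun u hu ↦ (hd u (hball hu)).differentiableAt.differentiableWithinAt)
    (fun u hu ↦ ((hd u (hball hu)).hasFDerivWithinAt.fderivWithin
      (Metric.isOpen_ball.uniqueDiffWithinAt hu)))
    (Set.mem_preimage.1 hyr) (Metric.mem_ball_self (x := e x₀) hr)
  change h (e.symm (e y)) = h (e.symm (e x₀)) at this
  rwa [e.left_inv hy, e.left_inv (mem_extChartAt_source x₀)] at this

end Constant

/-! ### Maps from a product, written in charts. -/

section ProductMap

variable {E : Type*} [NormedAddCommGroup E] [NormedSpace ℝ E]
  {M : Type*} [TopologicalSpace M] [ChartedSpace E M] [IsManifold 𝓘(ℝ, E) ∞ M]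
  {F₀ : Type*} [NormedAddCommGroup F₀] [NormedSpace ℝ F₀]
  {N₀ : Type*} [TopologicalSpace N₀] [ChartedSpace F₀ N₀] [IsManifold 𝓘(ℝ, F₀) ∞ N₀]
  {F₁ : Type*} [NormedAddCommGroup F₁] [NormedSpace ℝ F₁]
  {N₁ : Type*} [TopologicalSpace N₁] [ChartedSpace F₁ N₁] [IsManifold 𝓘(ℝ, F₁) ∞ N₁]

/-- The differential of `j` in the direction of the first factor. -/
def deriv₁ (j : N₀ × N₁ → M) (x : N₀) (y : N₁) :
    TangentSpace 𝓘(ℝ, F₀) x →L[ℝ] TangentSpace 𝓘(ℝ, E) (j (x, y)) :=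
  mfderiv 𝓘(ℝ, F₀) 𝓘(ℝ, E) (fun x' ↦ j (x', y)) x

/-- The differential of `j` in the direction of the second factor. -/
def deriv₂ (j : N₀ × N₁ → M) (x : N₀) (y : N₁) :
    TangentSpace 𝓘(ℝ, F₁) y →L[ℝ] TangentSpace 𝓘(ℝ, E) (j (x, y)) :=
  mfderiv 𝓘(ℝ, F₁) 𝓘(ℝ, E) (fun y' ↦ j (x, y')) y

variable (E F₀ F₁) in
/-- The expression of `j` in the charts at `x₀`, `y₀` and `j (x₀, y₀)`. -/
def inCharts (j : N₀ × N₁ → M) (x₀ : N₀) (y₀ : N₁) (q : F₀ × F₁) : E :=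
  extChartAt 𝓘(ℝ, E) (j (x₀, y₀))
    (j ((extChartAt 𝓘(ℝ, F₀) x₀).symm q.1, (extChartAt 𝓘(ℝ, F₁) y₀).symm q.2))

variable (E F₀ F₁) in
/-- The set where `inCharts` is the expression of `j` in charts. -/
def inChartsDomain (j : N₀ × N₁ → M) (x₀ : N₀) (y₀ : N₁) : Set (F₀ × F₁) :=
  {q | q.1 ∈ (extChartAt 𝓘(ℝ, F₀) x₀).target ∧ q.2 ∈ (extChartAt 𝓘(ℝ, F₁) y₀).target ∧
    j ((extChartAt 𝓘(ℝ, F₀) x₀).symm q.1, (extChartAt 𝓘(ℝ, F₁) y₀).symm q.2)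
      ∈ (extChartAt 𝓘(ℝ, E) (j (x₀, y₀))).source}

variable {j : N₀ × N₁ → M} {x₀ : N₀} {y₀ : N₁}

theorem inChartsDomain_mem_nhds (hj : Continuous j) :
    inChartsDomain E F₀ F₁ j x₀ y₀
      ∈ 𝓝 (extChartAt 𝓘(ℝ, F₀) x₀ x₀, extChartAt 𝓘(ℝ, F₁) y₀ y₀) := by
  have h₀ := extChartAt_target_mem_nhds (I := 𝓘(ℝ, F₀)) x₀
  have h₁ := extChartAt_target_mem_nhds (I := 𝓘(ℝ, F₁)) y₀
  have hc : ContinuousAt (fun q : F₀ × F₁ ↦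
      j ((extChartAt 𝓘(ℝ, F₀) x₀).symm q.1, (extChartAt 𝓘(ℝ, F₁) y₀).symm q.2))
      (extChartAt 𝓘(ℝ, F₀) x₀ x₀, extChartAt 𝓘(ℝ, F₁) y₀ y₀) :=
    hj.continuousAt.comp
      ((ContinuousAt.comp_of_eq (continuousAt_extChartAt_symm x₀) continuousAt_fst rfl).prodMk
        (ContinuousAt.comp_of_eq (continuousAt_extChartAt_symm y₀) continuousAt_snd rfl))
  have h₂ := hc.preimage_mem_nhds (t := (extChartAt 𝓘(ℝ, E) (j (x₀, y₀))).source) (by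
    simpa only [extChartAt_to_inv] using extChartAt_source_mem_nhds (I := 𝓘(ℝ, E)) (j (x₀, y₀)))
  filter_upwards [continuousAt_fst.preimage_mem_nhds h₀, continuousAt_snd.preimage_mem_nhds h₁, h₂]
    with q hq₀ hq₁ hq₂ using ⟨hq₀, hq₁, hq₂⟩

theorem contDiffAt_inCharts (hj : ContMDiff (𝓘(ℝ, F₀).prod 𝓘(ℝ, F₁)) 𝓘(ℝ, E) ∞ j) {q : F₀ × F₁}
    (hq : q ∈ inChartsDomain E F₀ F₁ j x₀ y₀) : ContDiffAt ℝ ∞ (inCharts E F₀ F₁ j x₀ y₀) q := by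
  rw [← contMDiffAt_iff_contDiffAt]
  have h₀ : ContMDiffAt 𝓘(ℝ, F₀ × F₁) 𝓘(ℝ, F₀) ∞
      (fun q : F₀ × F₁ ↦ (extChartAt 𝓘(ℝ, F₀) x₀).symm q.1) q :=
    ContMDiffAt.comp (I' := 𝓘(ℝ, F₀)) q ((contMDiffOn_extChartAt_symm x₀).contMDiffAt
      ((isOpen_extChartAt_target x₀).mem_nhds hq.1)) contDiff_fst.contMDiff.contMDiffAt
  have h₁ : ContMDiffAt 𝓘(ℝ, F₀ × F₁) 𝓘(ℝ, F₁) ∞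
      (fun q : F₀ × F₁ ↦ (extChartAt 𝓘(ℝ, F₁) y₀).symm q.2) q :=
    ContMDiffAt.comp (I' := 𝓘(ℝ, F₁)) q ((contMDiffOn_extChartAt_symm y₀).contMDiffAt
      ((isOpen_extChartAt_target y₀).mem_nhds hq.2.1)) contDiff_snd.contMDiff.contMDiffAt
  have h₂ : ContMDiffAt 𝓘(ℝ, F₀ × F₁) 𝓘(ℝ, E) ∞ (fun q : F₀ × F₁ ↦
      j ((extChartAt 𝓘(ℝ, F₀) x₀).symm q.1, (extChartAt 𝓘(ℝ, F₁) y₀).symm q.2)) q :=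
    hj.contMDiffAt.comp q (h₀.prodMk h₁)
  exact ContMDiffAt.comp (I' := 𝓘(ℝ, E)) q (contMDiffAt_extChartAt' (by simpa using hq.2.2)) h₂

theorem mem_inChartsDomain {x : N₀} {y : N₁} (hx : x ∈ (extChartAt 𝓘(ℝ, F₀) x₀).source)
    (hy : y ∈ (extChartAt 𝓘(ℝ, F₁) y₀).source)
    (hxy : j (x, y) ∈ (extChartAt 𝓘(ℝ, E) (j (x₀, y₀))).source) :
    (extChartAt 𝓘(ℝ, F₀) x₀ x, extChartAt 𝓘(ℝ, F₁) y₀ y) ∈ inChartsDomain E F₀ F₁ j x₀ y₀ := by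
  refine ⟨(extChartAt 𝓘(ℝ, F₀) x₀).map_source hx, (extChartAt 𝓘(ℝ, F₁) y₀).map_source hy, ?_⟩
  rwa [(extChartAt 𝓘(ℝ, F₀) x₀).left_inv hx, (extChartAt 𝓘(ℝ, F₁) y₀).left_inv hy]

theorem inCharts_extChartAt {x : N₀} {y : N₁} (hx : x ∈ (extChartAt 𝓘(ℝ, F₀) x₀).source)
    (hy : y ∈ (extChartAt 𝓘(ℝ, F₁) y₀).source) :
    inCharts E F₀ F₁ j x₀ y₀ (extChartAt 𝓘(ℝ, F₀) x₀ x, extChartAt 𝓘(ℝ, F₁) y₀ y)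
      = extChartAt 𝓘(ℝ, E) (j (x₀, y₀)) (j (x, y)) := by
  rw [inCharts, (extChartAt 𝓘(ℝ, F₀) x₀).left_inv hx, (extChartAt 𝓘(ℝ, F₁) y₀).left_inv hy]

/-- Near `x` the same map factors through the charts in two ways; uniqueness of the differential
compares them. The point `(x, y)` is not only the base point, because the resulting identities get
differentiated. -/
theorem fderiv_inCharts_left (hj : ContMDiff (𝓘(ℝ, F₀).prod 𝓘(ℝ, F₁)) 𝓘(ℝ, E) ∞ j)
    {x : N₀} {y : N₁} (hx : x ∈ (extChartAt 𝓘(ℝ, F₀) x₀).source)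
    (hy : y ∈ (extChartAt 𝓘(ℝ, F₁) y₀).source)
    (hxy : j (x, y) ∈ (extChartAt 𝓘(ℝ, E) (j (x₀, y₀))).source) (X : TangentSpace 𝓘(ℝ, F₀) x) :
    fderiv ℝ (inCharts E F₀ F₁ j x₀ y₀) (extChartAt 𝓘(ℝ, F₀) x₀ x, extChartAt 𝓘(ℝ, F₁) y₀ y)
        (chartDeriv x₀ x X, 0) = chartDeriv (j (x₀, y₀)) (j (x, y)) (deriv₁ j x y X) := by
  have h₁ : MDifferentiableAt 𝓘(ℝ, F₀) 𝓘(ℝ, E) (fun x' ↦ j (x', y)) x :=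
    (hj.comp (contMDiff_id.prodMk contMDiff_const)).mdifferentiableAt (by simp)
  have h₂ := HasMFDerivAt.comp (I' := 𝓘(ℝ, E)) x
    (mdifferentiableAt_extChartAt (I := 𝓘(ℝ, E)) (x := j (x₀, y₀))
      (by simpa using hxy)).hasMFDerivAt h₁.hasMFDerivAt
  have h₃ := ((contDiffAt_inCharts hj (mem_inChartsDomain hx hy hxy)).differentiableAt
    (by simp)).hasFDerivAt.comp (f := fun a ↦ (a, extChartAt 𝓘(ℝ, F₁) y₀ y))
      (extChartAt 𝓘(ℝ, F₀) x₀ x) (hasFDerivAt_prodMk_left _ _)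
  have h₄ := (hasMFDerivAt_iff_hasFDerivAt.2 h₃).comp (I' := 𝓘(ℝ, F₀)) x
    (mdifferentiableAt_extChartAt (I := 𝓘(ℝ, F₀)) (by simpa using hx)).hasMFDerivAt
  have h₅ : (inCharts E F₀ F₁ j x₀ y₀ ∘ fun a ↦ (a, extChartAt 𝓘(ℝ, F₁) y₀ y)) ∘
      extChartAt 𝓘(ℝ, F₀) x₀ =ᶠ[𝓝 x] extChartAt 𝓘(ℝ, E) (j (x₀, y₀)) ∘ fun x' ↦ j (x', y) := by
    filter_upwards [(isOpen_extChartAt_source (I := 𝓘(ℝ, F₀)) x₀).mem_nhds hx] with x' hx'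
    exact inCharts_extChartAt hx' hy
  exact DFunLike.congr_fun (hasMFDerivAt_unique h₄ (h₂.congr_of_eventuallyEq h₅)) X

theorem fderiv_inCharts_right (hj : ContMDiff (𝓘(ℝ, F₀).prod 𝓘(ℝ, F₁)) 𝓘(ℝ, E) ∞ j)
    {x : N₀} {y : N₁} (hx : x ∈ (extChartAt 𝓘(ℝ, F₀) x₀).source)
    (hy : y ∈ (extChartAt 𝓘(ℝ, F₁) y₀).source)
    (hxy : j (x, y) ∈ (extChartAt 𝓘(ℝ, E) (j (x₀, y₀))).source) (V : TangentSpace 𝓘(ℝ, F₁) y) :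
    fderiv ℝ (inCharts E F₀ F₁ j x₀ y₀) (extChartAt 𝓘(ℝ, F₀) x₀ x, extChartAt 𝓘(ℝ, F₁) y₀ y)
        (0, chartDeriv y₀ y V) = chartDeriv (j (x₀, y₀)) (j (x, y)) (deriv₂ j x y V) := by
  have h₁ : MDifferentiableAt 𝓘(ℝ, F₁) 𝓘(ℝ, E) (fun y' ↦ j (x, y')) y :=
    (hj.comp (contMDiff_const.prodMk contMDiff_id)).mdifferentiableAt (by simp)
  have h₂ := HasMFDerivAt.comp (I' := 𝓘(ℝ, E)) y
    (mdifferentiableAt_extChartAt (I := 𝓘(ℝ, E)) (x := j (x₀, y₀))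
      (by simpa using hxy)).hasMFDerivAt h₁.hasMFDerivAt
  have h₃ := ((contDiffAt_inCharts hj (mem_inChartsDomain hx hy hxy)).differentiableAt
    (by simp)).hasFDerivAt.comp (f := fun b ↦ (extChartAt 𝓘(ℝ, F₀) x₀ x, b))
      (extChartAt 𝓘(ℝ, F₁) y₀ y) (hasFDerivAt_prodMk_right _ _)
  have h₄ := (hasMFDerivAt_iff_hasFDerivAt.2 h₃).comp (I' := 𝓘(ℝ, F₁)) y
    (mdifferentiableAt_extChartAt (I := 𝓘(ℝ, F₁)) (by simpa using hy)).hasMFDerivAt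
  have h₅ : (inCharts E F₀ F₁ j x₀ y₀ ∘ fun b ↦ (extChartAt 𝓘(ℝ, F₀) x₀ x, b)) ∘
      extChartAt 𝓘(ℝ, F₁) y₀ =ᶠ[𝓝 y] extChartAt 𝓘(ℝ, E) (j (x₀, y₀)) ∘ fun y' ↦ j (x, y') := by
    filter_upwards [(isOpen_extChartAt_source (I := 𝓘(ℝ, F₁)) y₀).mem_nhds hy] with y' hy'
    exact inCharts_extChartAt hx hy'
  exact DFunLike.congr_fun (hasMFDerivAt_unique h₄ (h₂.congr_of_eventuallyEq h₅)) V

theorem exists_of_mem_inChartsDomain {q : F₀ × F₁} (hq : q ∈ inChartsDomain E F₀ F₁ j x₀ y₀) :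
    ∃ x y, x ∈ (extChartAt 𝓘(ℝ, F₀) x₀).source ∧ y ∈ (extChartAt 𝓘(ℝ, F₁) y₀).source ∧
      j (x, y) ∈ (extChartAt 𝓘(ℝ, E) (j (x₀, y₀))).source ∧
      q = (extChartAt 𝓘(ℝ, F₀) x₀ x, extChartAt 𝓘(ℝ, F₁) y₀ y) :=
  ⟨_, _, (extChartAt 𝓘(ℝ, F₀) x₀).map_target hq.1, (extChartAt 𝓘(ℝ, F₁) y₀).map_target hq.2.1,
    hq.2.2, Prod.ext ((extChartAt 𝓘(ℝ, F₀) x₀).right_inv hq.1).symm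
      ((extChartAt 𝓘(ℝ, F₁) y₀).right_inv hq.2.1).symm⟩

end ProductMap

/-! ### The Kähler form along a product with vanishing mixed part. -/

section KahlerProduct

variable {E : Type*} [NormedAddCommGroup E] [NormedSpace ℝ E] [FiniteDimensional ℝ E]
  {M : Type*} [TopologicalSpace M] [ChartedSpace E M] [IsManifold 𝓘(ℝ, E) ∞ M]
  [RiemannianBundle (fun x : M ↦ TangentSpace 𝓘(ℝ, E) x)]
  [IsContMDiffRiemannianBundle 𝓘(ℝ, E) ∞ E (fun x : M ↦ TangentSpace 𝓘(ℝ, E) x)]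
  {J : ∀ x : M, TangentSpace 𝓘(ℝ, E) x →L[ℝ] TangentSpace 𝓘(ℝ, E) x}
  {F₀ : Type*} [NormedAddCommGroup F₀] [NormedSpace ℝ F₀]
  {N₀ : Type*} [TopologicalSpace N₀] [ChartedSpace F₀ N₀] [IsManifold 𝓘(ℝ, F₀) ∞ N₀]
  {F₁ : Type*} [NormedAddCommGroup F₁] [NormedSpace ℝ F₁]
  {N₁ : Type*} [TopologicalSpace N₁] [ChartedSpace F₁ N₁] [IsManifold 𝓘(ℝ, F₁) ∞ N₁]
  {j : N₀ × N₁ → M}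

/-- If the Kähler form vanishes on pairs of vectors tangent to the two factors of a product, its
restriction to the second factor does not depend on the point of the first one. -/
theorem IsKahler.hasMFDerivAt_inner_deriv₂ (hJ : IsKahler J)
    (hj : ContMDiff (𝓘(ℝ, F₀).prod 𝓘(ℝ, F₁)) 𝓘(ℝ, E) ∞ j)
    (hmix : ∀ (x : N₀) (y : N₁) (X : TangentSpace 𝓘(ℝ, F₀) x) (V : TangentSpace 𝓘(ℝ, F₁) y),
      inner ℝ (J (j (x, y)) (deriv₁ j x y X)) (deriv₂ j x y V) = 0)
    (x₀ : N₀) (y₀ : N₁) (V W : TangentSpace 𝓘(ℝ, F₁) y₀) :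
    HasMFDerivAt 𝓘(ℝ, F₀) 𝓘(ℝ, ℝ)
      (fun x ↦ (inner ℝ (J (j (x, y₀)) (deriv₂ j x y₀ V)) (deriv₂ j x y₀ W) : ℝ)) x₀ 0 := by
  set q₀ : F₀ × F₁ := (extChartAt 𝓘(ℝ, F₀) x₀ x₀, extChartAt 𝓘(ℝ, F₁) y₀ y₀) with hq₀
  set G := inCharts E F₀ F₁ j x₀ y₀ with hG
  set Ω := kahlerFormInChart J (j (x₀, y₀)) with hΩ
  have hU : inChartsDomain E F₀ F₁ j x₀ y₀ ∈ 𝓝 q₀ := inChartsDomain_mem_nhds hj.continuous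
  have hGq₀ : G q₀ = extChartAt 𝓘(ℝ, E) (j (x₀, y₀)) (j (x₀, y₀)) := by
    simp [hG, hq₀, inCharts]
  -- Vanishing is needed on a whole neighbourhood, since the closedness identity differentiates
  -- these mixed terms.
  have hzero : ∀ α β, (fun p ↦ Ω (G p) (fderiv ℝ G p (α, 0)) (fderiv ℝ G p (0, β)))
      =ᶠ[𝓝 q₀] fun _ ↦ 0 := fun α β ↦ by
    filter_upwards [hU] with q hq
    obtain ⟨x, y, hx, hy, hxy, rfl⟩ := exists_of_mem_inChartsDomain hq
    rw [← chartDeriv_coordField hx α, ← chartDeriv_coordField hy β,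
      fderiv_inCharts_left hj hx hy hxy, fderiv_inCharts_right hj hx hy hxy, hG,
      inCharts_extChartAt hx hy]
    exact (kahlerFormInChart_extChartAt hxy _ _).trans (hmix _ _ _ _)
  have hzero' : ∀ α β, (fun p ↦ Ω (G p) (fderiv ℝ G p (0, β)) (fderiv ℝ G p (α, 0)))
      =ᶠ[𝓝 q₀] fun _ ↦ 0 := fun α β ↦ by
    filter_upwards [hzero α β] with q hq
    rw [hJ.kahlerFormInChart_swap, hq, neg_zero]
  have hΩd : DifferentiableAt ℝ Ω (G q₀) := by
    rw [hGq₀]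
    exact hJ.differentiableAt_kahlerFormInChart (mem_extChartAt_source _)
  have hGd : ContDiffAt ℝ 2 G q₀ :=
    (contDiffAt_inCharts hj (mem_of_mem_nhds hU)).of_le ENat.LEInfty.out
  have hclosed := fun α β γ ↦ pullback_closed hΩd hGd
    (fun a b ↦ hJ.kahlerFormInChart_swap _ _ a b)
    (fun a b c ↦ by
      rw [hGq₀]
      exact hJ.closed_kahlerFormInChart (mem_extChartAt_source _) a b c) α β γ
  set v : F₁ := chartDeriv y₀ y₀ V with hv
  set w : F₁ := chartDeriv y₀ y₀ W with hw
  have hP := (hasFDerivAt_pullback hΩd hGd (0, v) (0, w)).1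
  -- Of the three terms of closedness on `(α, 0)`, `(0, v)`, `(0, w)`, the two others differentiate
  -- locally zero functions.
  have hP0 : ∀ α, fderiv ℝ (fun p ↦ Ω (G p) (fderiv ℝ G p (0, v)) (fderiv ℝ G p (0, w))) q₀ (α, 0)
      = 0 := fun α ↦ by
    have := hclosed (α, 0) (0, v) (0, w)
    rw [(hzero α v).fderiv_eq, (hzero' α w).fderiv_eq] at this
    simpa using this
  have hF : HasFDerivAt (fun a : F₀ ↦ Ω (G (a, q₀.2)) (fderiv ℝ G (a, q₀.2) (0, v))
      (fderiv ℝ G (a, q₀.2) (0, w))) (0 : F₀ →L[ℝ] ℝ) q₀.1 := by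
    have := hP.hasFDerivAt.comp (f := fun a ↦ (a, q₀.2)) q₀.1 (hasFDerivAt_prodMk_left q₀.1 q₀.2)
    refine this.congr_fderiv (ContinuousLinearMap.ext fun α ↦ ?_)
    exact hP0 α
  have hcomp := (hasMFDerivAt_iff_hasFDerivAt.2 hF).comp (I' := 𝓘(ℝ, F₀)) x₀
    (mdifferentiableAt_extChartAt (I := 𝓘(ℝ, F₀)) (mem_chart_source F₀ x₀)).hasMFDerivAt
  refine (hcomp.congr_of_eventuallyEq ?_).congr_mfderiv (ContinuousLinearMap.zero_comp _)
  have hc : ContinuousAt (fun x ↦ j (x, y₀)) x₀ :=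
    hj.continuous.continuousAt.comp (continuousAt_id.prodMk continuousAt_const)
  filter_upwards [extChartAt_source_mem_nhds (I := 𝓘(ℝ, F₀)) x₀,
    hc.preimage_mem_nhds (extChartAt_source_mem_nhds (I := 𝓘(ℝ, E)) (j (x₀, y₀)))] with x hx hxy
  have hy := mem_extChartAt_source (I := 𝓘(ℝ, F₁)) y₀
  -- Since `y₀` stays fixed as `x` moves, `V` and `W` keep the constant coordinates `v` and `w`.
  change _ = Ω (inCharts E F₀ F₁ j x₀ y₀
      (extChartAt 𝓘(ℝ, F₀) x₀ x, extChartAt 𝓘(ℝ, F₁) y₀ y₀))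
    (fderiv ℝ (inCharts E F₀ F₁ j x₀ y₀)
      (extChartAt 𝓘(ℝ, F₀) x₀ x, extChartAt 𝓘(ℝ, F₁) y₀ y₀) (0, chartDeriv y₀ y₀ V))
    (fderiv ℝ (inCharts E F₀ F₁ j x₀ y₀)
      (extChartAt 𝓘(ℝ, F₀) x₀ x, extChartAt 𝓘(ℝ, F₁) y₀ y₀) (0, chartDeriv y₀ y₀ W))
  rw [fderiv_inCharts_right hj hx hy hxy, fderiv_inCharts_right hj hx hy hxy,
    inCharts_extChartAt hx hy]
  exact (kahlerFormInChart_extChartAt hxy _ _).symm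

end KahlerProduct

/-! ### Slant angle and length of the tangential part. -/

theorem norm_starProjection_of_angleToSubspace {V : Type*} [NormedAddCommGroup V]
    [InnerProductSpace ℝ V] {u : V} {W : Submodule ℝ V} [W.HasOrthogonalProjection] {θ : ℝ}
    (h : angleToSubspace u W = θ) : ‖W.starProjection u‖ = Real.cos θ * ‖u‖ := by
  have h₁ := InnerProductGeometry.cos_angle_mul_norm_mul_norm u (W.starProjection u)
  have h₂ : inner ℝ u (W.starProjection u) = ‖W.starProjection u‖ * ‖W.starProjection u‖ := by
    have := W.starProjection_inner_eq_zero u _ (W.starProjection_apply_mem u)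
    rw [inner_sub_left, sub_eq_zero] at this
    rw [this, real_inner_self_eq_norm_mul_norm]
  rw [show InnerProductGeometry.angle u (W.starProjection u) = θ from h, h₂] at h₁
  rcases eq_or_ne ‖W.starProjection u‖ 0 with h₀ | h₀
  -- Here $\|Pu\|^2=\cos\theta\,\|u\|\,\|Pu\|$ cannot be divided by $\|Pu\|$; the convention that
  -- the angle with `0` is $\pi/2$ settles it.
  · have hθ : θ = Real.pi / 2 := by
      rw [← h, angleToSubspace, norm_eq_zero.1 h₀, InnerProductGeometry.angle_zero_right]
    rw [h₀, hθ, Real.cos_pi_div_two, zero_mul]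
  · exact mul_right_cancel₀ h₀ (by linarith)

/-! ### The induced metric on the first two factors. -/

section Biwarped

variable {E : Type*} [NormedAddCommGroup E] [NormedSpace ℝ E] [FiniteDimensional ℝ E]
  {M : Type*} [TopologicalSpace M] [ChartedSpace E M]
  [RiemannianBundle (fun x : M ↦ TangentSpace 𝓘(ℝ, E) x)]
  {E₀ : Type*} [NormedAddCommGroup E₀] [NormedSpace ℝ E₀]
  {MT : Type*} [TopologicalSpace MT] [ChartedSpace E₀ MT]
  [RiemannianBundle (fun x : MT ↦ TangentSpace 𝓘(ℝ, E₀) x)]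
  {E₁ : Type*} [NormedAddCommGroup E₁] [NormedSpace ℝ E₁]
  {Mφ : Type*} [TopologicalSpace Mφ] [ChartedSpace E₁ Mφ]
  [RiemannianBundle (fun x : Mφ ↦ TangentSpace 𝓘(ℝ, E₁) x)]
  {E₂ : Type*} [NormedAddCommGroup E₂] [NormedSpace ℝ E₂]
  {Mperp : Type*} [TopologicalSpace Mperp] [ChartedSpace E₂ Mperp]
  [RiemannianBundle (fun x : Mperp ↦ TangentSpace 𝓘(ℝ, E₂) x)]
  {f σ : MT → ℝ} {i : MT × Mφ × Mperp → M}

/-- This lemma and the five similar ones after it give the components that `biwarpedMetric` sees of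
vectors tangent to leaves of $M_T$ and $M_\varphi$: a projection after a leaf inclusion is the
identity or constant. -/
theorem mfderiv_fst_mk (x : MT) (y : Mφ) (z : Mperp) (X : TangentSpace 𝓘(ℝ, E₀) x) :
    mfderiv (prodModel E₀ E₁ E₂) 𝓘(ℝ, E₀) (fun q : MT × Mφ × Mperp ↦ q.1) (x, y, z)
      (mfderiv 𝓘(ℝ, E₀) (prodModel E₀ E₁ E₂) (fun x' ↦ (x', y, z)) x X) = X := by
  have h := mfderiv_comp (I := 𝓘(ℝ, E₀)) (I' := prodModel E₀ E₁ E₂) (I'' := 𝓘(ℝ, E₀)) x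
    (g := fun q : MT × Mφ × Mperp ↦ q.1) (f := fun x' ↦ (x', y, z))
    mdifferentiableAt_fst (mdifferentiableAt_id.prodMk mdifferentiableAt_const)
  exact (DFunLike.congr_fun h X).symm.trans (DFunLike.congr_fun (mfderiv_id (I := 𝓘(ℝ, E₀))) X)

theorem mfderiv_snd_fst_mk (x : MT) (y : Mφ) (z : Mperp) (X : TangentSpace 𝓘(ℝ, E₀) x) :
    mfderiv (prodModel E₀ E₁ E₂) 𝓘(ℝ, E₁) (fun q : MT × Mφ × Mperp ↦ q.2.1) (x, y, z)
      (mfderiv 𝓘(ℝ, E₀) (prodModel E₀ E₁ E₂) (fun x' ↦ (x', y, z)) x X) = 0 := by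
  have h := mfderiv_comp (I := 𝓘(ℝ, E₀)) (I' := prodModel E₀ E₁ E₂) (I'' := 𝓘(ℝ, E₁)) x
    (g := fun q : MT × Mφ × Mperp ↦ q.2.1) (f := fun x' ↦ (x', y, z))
    (MDifferentiableAt.comp (I' := 𝓘(ℝ, E₁).prod 𝓘(ℝ, E₂)) (x, y, z)
      (g := fun q : Mφ × Mperp ↦ q.1) (f := fun q : MT × Mφ × Mperp ↦ q.2)
      mdifferentiableAt_fst mdifferentiableAt_snd)
    (mdifferentiableAt_id.prodMk mdifferentiableAt_const)
  exact (DFunLike.congr_fun h X).symm.trans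
    (DFunLike.congr_fun (mfderiv_const (I := 𝓘(ℝ, E₀)) (I' := 𝓘(ℝ, E₁)) (c := y)) X)

theorem mfderiv_snd_snd_mk (x : MT) (y : Mφ) (z : Mperp) (X : TangentSpace 𝓘(ℝ, E₀) x) :
    mfderiv (prodModel E₀ E₁ E₂) 𝓘(ℝ, E₂) (fun q : MT × Mφ × Mperp ↦ q.2.2) (x, y, z)
      (mfderiv 𝓘(ℝ, E₀) (prodModel E₀ E₁ E₂) (fun x' ↦ (x', y, z)) x X) = 0 := by
  have h := mfderiv_comp (I := 𝓘(ℝ, E₀)) (I' := prodModel E₀ E₁ E₂) (I'' := 𝓘(ℝ, E₂)) x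
    (g := fun q : MT × Mφ × Mperp ↦ q.2.2) (f := fun x' ↦ (x', y, z))
    (MDifferentiableAt.comp (I' := 𝓘(ℝ, E₁).prod 𝓘(ℝ, E₂)) (x, y, z)
      (g := fun q : Mφ × Mperp ↦ q.2) (f := fun q : MT × Mφ × Mperp ↦ q.2)
      mdifferentiableAt_snd mdifferentiableAt_snd)
    (mdifferentiableAt_id.prodMk mdifferentiableAt_const)
  exact (DFunLike.congr_fun h X).symm.trans
    (DFunLike.congr_fun (mfderiv_const (I := 𝓘(ℝ, E₀)) (I' := 𝓘(ℝ, E₂)) (c := z)) X)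

theorem mfderiv_fst_mk_snd (x : MT) (y : Mφ) (z : Mperp) (V : TangentSpace 𝓘(ℝ, E₁) y) :
    mfderiv (prodModel E₀ E₁ E₂) 𝓘(ℝ, E₀) (fun q : MT × Mφ × Mperp ↦ q.1) (x, y, z)
      (mfderiv 𝓘(ℝ, E₁) (prodModel E₀ E₁ E₂) (fun y' ↦ (x, y', z)) y V) = 0 := by
  have h := mfderiv_comp (I := 𝓘(ℝ, E₁)) (I' := prodModel E₀ E₁ E₂) (I'' := 𝓘(ℝ, E₀)) y
    (g := fun q : MT × Mφ × Mperp ↦ q.1) (f := fun y' ↦ (x, y', z)) mdifferentiableAt_fst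
    (mdifferentiableAt_const.prodMk (mdifferentiableAt_id.prodMk mdifferentiableAt_const))
  exact (DFunLike.congr_fun h V).symm.trans
    (DFunLike.congr_fun (mfderiv_const (I := 𝓘(ℝ, E₁)) (I' := 𝓘(ℝ, E₀)) (c := x)) V)

theorem mfderiv_snd_fst_mk_snd (x : MT) (y : Mφ) (z : Mperp) (V : TangentSpace 𝓘(ℝ, E₁) y) :
    mfderiv (prodModel E₀ E₁ E₂) 𝓘(ℝ, E₁) (fun q : MT × Mφ × Mperp ↦ q.2.1) (x, y, z)
      (mfderiv 𝓘(ℝ, E₁) (prodModel E₀ E₁ E₂) (fun y' ↦ (x, y', z)) y V) = V := by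
  have h := mfderiv_comp (I := 𝓘(ℝ, E₁)) (I' := prodModel E₀ E₁ E₂) (I'' := 𝓘(ℝ, E₁)) y
    (g := fun q : MT × Mφ × Mperp ↦ q.2.1) (f := fun y' ↦ (x, y', z))
    (MDifferentiableAt.comp (I' := 𝓘(ℝ, E₁).prod 𝓘(ℝ, E₂)) (x, y, z)
      (g := fun q : Mφ × Mperp ↦ q.1) (f := fun q : MT × Mφ × Mperp ↦ q.2)
      mdifferentiableAt_fst mdifferentiableAt_snd)
    (mdifferentiableAt_const.prodMk (mdifferentiableAt_id.prodMk mdifferentiableAt_const))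
  exact (DFunLike.congr_fun h V).symm.trans (DFunLike.congr_fun (mfderiv_id (I := 𝓘(ℝ, E₁))) V)

theorem mfderiv_snd_snd_mk_snd (x : MT) (y : Mφ) (z : Mperp) (V : TangentSpace 𝓘(ℝ, E₁) y) :
    mfderiv (prodModel E₀ E₁ E₂) 𝓘(ℝ, E₂) (fun q : MT × Mφ × Mperp ↦ q.2.2) (x, y, z)
      (mfderiv 𝓘(ℝ, E₁) (prodModel E₀ E₁ E₂) (fun y' ↦ (x, y', z)) y V) = 0 := by
  have h := mfderiv_comp (I := 𝓘(ℝ, E₁)) (I' := prodModel E₀ E₁ E₂) (I'' := 𝓘(ℝ, E₂)) y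
    (g := fun q : MT × Mφ × Mperp ↦ q.2.2) (f := fun y' ↦ (x, y', z))
    (MDifferentiableAt.comp (I' := 𝓘(ℝ, E₁).prod 𝓘(ℝ, E₂)) (x, y, z)
      (g := fun q : Mφ × Mperp ↦ q.2) (f := fun q : MT × Mφ × Mperp ↦ q.2)
      mdifferentiableAt_snd mdifferentiableAt_snd)
    (mdifferentiableAt_const.prodMk (mdifferentiableAt_id.prodMk mdifferentiableAt_const))
  exact (DFunLike.congr_fun h V).symm.trans
    (DFunLike.congr_fun (mfderiv_const (I := 𝓘(ℝ, E₁)) (I' := 𝓘(ℝ, E₂)) (c := z)) V)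

namespace IsBiwarpedProductSubmanifold

theorem deriv₁_eq
    (hi : IsBiwarpedProductSubmanifold (E := E) (E₀ := E₀) (E₁ := E₁) (E₂ := E₂) f σ i)
    (x : MT) (y : Mφ) (z : Mperp) (X : TangentSpace 𝓘(ℝ, E₀) x) :
    deriv₁ (fun p : MT × Mφ ↦ i (p.1, p.2, z)) x y X
      = mfderiv (prodModel E₀ E₁ E₂) 𝓘(ℝ, E) i (x, y, z)
        (mfderiv 𝓘(ℝ, E₀) (prodModel E₀ E₁ E₂) (fun x' ↦ (x', y, z)) x X) :=
  DFunLike.congr_fun (mfderiv_comp (I := 𝓘(ℝ, E₀)) (I' := prodModel E₀ E₁ E₂) (I'' := 𝓘(ℝ, E)) x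
    (g := i) (f := fun x' ↦ (x', y, z)) (hi.contMDiff.mdifferentiableAt (by simp))
    (mdifferentiableAt_id.prodMk mdifferentiableAt_const)) X

theorem deriv₂_eq
    (hi : IsBiwarpedProductSubmanifold (E := E) (E₀ := E₀) (E₁ := E₁) (E₂ := E₂) f σ i)
    (x : MT) (y : Mφ) (z : Mperp) (V : TangentSpace 𝓘(ℝ, E₁) y) :
    deriv₂ (fun p : MT × Mφ ↦ i (p.1, p.2, z)) x y V
      = mfderiv (prodModel E₀ E₁ E₂) 𝓘(ℝ, E) i (x, y, z)
        (mfderiv 𝓘(ℝ, E₁) (prodModel E₀ E₁ E₂) (fun y' ↦ (x, y', z)) y V) :=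
  DFunLike.congr_fun (mfderiv_comp (I := 𝓘(ℝ, E₁)) (I' := prodModel E₀ E₁ E₂) (I'' := 𝓘(ℝ, E)) y
    (g := i) (f := fun y' ↦ (x, y', z)) (hi.contMDiff.mdifferentiableAt (by simp))
    (mdifferentiableAt_const.prodMk (mdifferentiableAt_id.prodMk mdifferentiableAt_const))) V

theorem inner_deriv₁_deriv₂
    (hi : IsBiwarpedProductSubmanifold (E := E) (E₀ := E₀) (E₁ := E₁) (E₂ := E₂) f σ i)
    (x : MT) (y : Mφ) (z : Mperp) (X : TangentSpace 𝓘(ℝ, E₀) x)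
    (V : TangentSpace 𝓘(ℝ, E₁) y) :
    inner ℝ (deriv₁ (E := E) (fun p : MT × Mφ ↦ i (p.1, p.2, z)) x y X)
      (deriv₂ (fun p : MT × Mφ ↦ i (p.1, p.2, z)) x y V) = 0 := by
  rw [hi.deriv₁_eq, hi.deriv₂_eq]
  refine (hi.isometric (x, y, z) _ _).trans ?_
  rw [biwarpedMetric, mfderiv_snd_fst_mk, mfderiv_snd_snd_mk, mfderiv_fst_mk_snd]
  simp

theorem inner_deriv₂_deriv₂
    (hi : IsBiwarpedProductSubmanifold (E := E) (E₀ := E₀) (E₁ := E₁) (E₂ := E₂) f σ i)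
    (x : MT) (y : Mφ) (z : Mperp) (V W : TangentSpace 𝓘(ℝ, E₁) y) :
    inner ℝ (deriv₂ (E := E) (fun p : MT × Mφ ↦ i (p.1, p.2, z)) x y V)
      (deriv₂ (fun p : MT × Mφ ↦ i (p.1, p.2, z)) x y W) = f x ^ 2 * inner ℝ V W := by
  rw [hi.deriv₂_eq, hi.deriv₂_eq]
  refine (hi.isometric (x, y, z) _ _).trans ?_
  rw [biwarpedMetric, mfderiv_fst_mk_snd, mfderiv_snd_fst_mk_snd, mfderiv_snd_fst_mk_snd,
    mfderiv_snd_snd_mk_snd]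
  simp

theorem norm_deriv₂
    (hi : IsBiwarpedProductSubmanifold (E := E) (E₀ := E₀) (E₁ := E₁) (E₂ := E₂) f σ i)
    (x : MT) (y : Mφ) (z : Mperp) (V : TangentSpace 𝓘(ℝ, E₁) y) :
    ‖deriv₂ (E := E) (fun p : MT × Mφ ↦ i (p.1, p.2, z)) x y V‖ = f x * ‖V‖ := by
  rw [← sq_eq_sq₀ (norm_nonneg _) (mul_nonneg (hi.pos₁ x).le (norm_nonneg _)), mul_pow,
    ← real_inner_self_eq_norm_sq, ← real_inner_self_eq_norm_sq]
  exact hi.inner_deriv₂_deriv₂ x y z V V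

end IsBiwarpedProductSubmanifold

end Biwarped

end

/-! ### Constancy of the warping function. -/

theorem mainTheorem6
    -- the Kähler manifold `(M, J, g)`
    {E : Type*} [NormedAddCommGroup E] [NormedSpace ℝ E] [FiniteDimensional ℝ E]
    {M : Type*} [TopologicalSpace M] [ChartedSpace E M] [IsManifold 𝓘(ℝ, E) ∞ M]
    [RiemannianBundle (fun x : M ↦ TangentSpace 𝓘(ℝ, E) x)]
    [IsContMDiffRiemannianBundle 𝓘(ℝ, E) ∞ E (fun x : M ↦ TangentSpace 𝓘(ℝ, E) x)]
    (J : ∀ x : M, TangentSpace 𝓘(ℝ, E) x →L[ℝ] TangentSpace 𝓘(ℝ, E) x) (hJ : IsKahler J)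
    -- the Riemannian manifolds `M_T`, `M_φ` and `M_⊥`
    {E₀ : Type*} [NormedAddCommGroup E₀] [NormedSpace ℝ E₀] [FiniteDimensional ℝ E₀]
    {MT : Type*} [TopologicalSpace MT] [ChartedSpace E₀ MT] [IsManifold 𝓘(ℝ, E₀) ∞ MT]
    [RiemannianBundle (fun x : MT ↦ TangentSpace 𝓘(ℝ, E₀) x)]
    [IsContMDiffRiemannianBundle 𝓘(ℝ, E₀) ∞ E₀ (fun x : MT ↦ TangentSpace 𝓘(ℝ, E₀) x)]
    [ConnectedSpace MT]
    {E₁ : Type*} [NormedAddCommGroup E₁] [NormedSpace ℝ E₁] [FiniteDimensional ℝ E₁]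
    [Nontrivial E₁]
    {Mφ : Type*} [TopologicalSpace Mφ] [ChartedSpace E₁ Mφ] [IsManifold 𝓘(ℝ, E₁) ∞ Mφ]
    [RiemannianBundle (fun x : Mφ ↦ TangentSpace 𝓘(ℝ, E₁) x)]
    [IsContMDiffRiemannianBundle 𝓘(ℝ, E₁) ∞ E₁ (fun x : Mφ ↦ TangentSpace 𝓘(ℝ, E₁) x)]
    [Nonempty Mφ]
    {E₂ : Type*} [NormedAddCommGroup E₂] [NormedSpace ℝ E₂] [FiniteDimensional ℝ E₂]
    {Mperp : Type*} [TopologicalSpace Mperp] [ChartedSpace E₂ Mperp]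
    [IsManifold 𝓘(ℝ, E₂) ∞ Mperp]
    [RiemannianBundle (fun x : Mperp ↦ TangentSpace 𝓘(ℝ, E₂) x)]
    [IsContMDiffRiemannianBundle 𝓘(ℝ, E₂) ∞ E₂ (fun x : Mperp ↦ TangentSpace 𝓘(ℝ, E₂) x)]
    [Nonempty Mperp]
    -- the biwarped product submanifold `M_T ×_f M_φ ×_σ M_⊥` of `M`
    (f σ : MT → ℝ) (i : MT × Mφ × Mperp → M)
    (hi : IsBiwarpedProductSubmanifold (E := E) (E₀ := E₀) (E₁ := E₁) (E₂ := E₂) f σ i)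
    -- the factor `M_T` is holomorphic, `M_φ` is proper slant and `M_⊥` is totally real
    (hT : ∀ (y : Mφ) (z : Mperp),
      IsHolomorphicSubmanifold (F := E₀) J (fun x : MT ↦ i (x, y, z)))
    (φ : ℝ) (hφ : φ ∈ Set.Ioo 0 (Real.pi / 2))
    (hslant : ∀ (x : MT) (z : Mperp),
      IsSlantSubmanifold (F := E₁) J (fun y : Mφ ↦ i (x, y, z)) φ)
    (hperp : ∀ (x : MT) (y : Mφ),
      IsTotallyRealSubmanifold (F := E₂) J (fun z : Mperp ↦ i (x, y, z))) :
    ∃ c : ℝ, ∀ x : MT, f x = c := by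
  obtain ⟨y⟩ := ‹Nonempty Mφ›
  obtain ⟨z⟩ := ‹Nonempty Mperp›
  obtain ⟨x₀⟩ := (inferInstance : Nonempty MT)
  obtain ⟨V, hV⟩ : ∃ V : TangentSpace 𝓘(ℝ, E₁) y, V ≠ 0 := exists_ne (0 : E₁)
  set j : MT × Mφ → M := fun p ↦ i (p.1, p.2, z) with hj_def
  have hj : ContMDiff (𝓘(ℝ, E₀).prod 𝓘(ℝ, E₁)) 𝓘(ℝ, E) ∞ j :=
    hi.contMDiff.comp (contMDiff_fst.prodMk (contMDiff_snd.prodMk contMDiff_const))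
  have hmix : ∀ (x : MT) (y : Mφ) (X : TangentSpace 𝓘(ℝ, E₀) x) (V : TangentSpace 𝓘(ℝ, E₁) y),
      inner ℝ (J (j (x, y)) (deriv₁ j x y X)) (deriv₂ j x y V) = 0 := fun x y X V ↦ by
    -- Holomorphy makes `J` of an $M_T$-vector again an $M_T$-vector, hence orthogonal to the slant
    -- leaf.
    obtain ⟨X', hX'⟩ := hT y z x (deriv₁ j x y X) ⟨X, rfl⟩
    rw [← hX']
    exact hi.inner_deriv₁_deriv₂ x y z X' V
  have hconst := fun (V W : TangentSpace 𝓘(ℝ, E₁) y) ↦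
    eq_of_hasMFDerivAt_zero (fun x ↦ hJ.hasMFDerivAt_inner_deriv₂ hj hmix x y V W)
  have hVpos : 0 < ‖V‖ := norm_pos_iff.2 hV
  -- `U` is the vector on $M_\varphi$ whose image is the tangential part of $JV$. It may depend on
  -- `x`, but its norm does not: the factor `f x` scales both `U` and `V` and cancels.
  have hU : ∀ x, ∃ U : TangentSpace 𝓘(ℝ, E₁) y,
      ‖U‖ = Real.cos φ * ‖V‖ ∧
      ∀ W : TangentSpace 𝓘(ℝ, E₁) y,
        inner ℝ (J (j (x, y)) (deriv₂ j x y V)) (deriv₂ j x y W) = f x ^ 2 * inner ℝ U W := by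
    intro x
    set T : Submodule ℝ (TangentSpace 𝓘(ℝ, E) (j (x, y))) :=
      tangentImage (E := E) (F := E₁) (fun y ↦ i (x, y, z)) y
    have : FiniteDimensional ℝ (TangentSpace 𝓘(ℝ, E) (j (x, y))) :=
      inferInstanceAs (FiniteDimensional ℝ E)
    have hnorm : ‖J (j (x, y)) (deriv₂ j x y V)‖ = ‖deriv₂ (E := E) j x y V‖ := by
      rw [← sq_eq_sq₀ (norm_nonneg _) (norm_nonneg _), ← real_inner_self_eq_norm_sq,
        ← real_inner_self_eq_norm_sq, hJ.hermitian]
    have hne : deriv₂ (E := E) j x y V ≠ 0 := by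
      rw [← norm_pos_iff, hi.norm_deriv₂ x y z V]
      exact mul_pos (hi.pos₁ x) hVpos
    have hang : angleToSubspace (J (j (x, y)) (deriv₂ j x y V)) T = φ :=
      hslant x z y (deriv₂ j x y V) ⟨V, rfl⟩ hne
    obtain ⟨U, hUT⟩ : ∃ U, deriv₂ j x y U = T.starProjection (J (j (x, y)) (deriv₂ j x y V)) :=
      T.starProjection_apply_mem _
    refine ⟨U, mul_left_cancel₀ (hi.pos₁ x).ne' ?_, fun W ↦ ?_⟩
    · rw [← hi.norm_deriv₂ x y z U, hUT, norm_starProjection_of_angleToSubspace hang, hnorm,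
        hi.norm_deriv₂ x y z V]
      ring
    · have h := T.starProjection_inner_eq_zero (J (j (x, y)) (deriv₂ j x y V)) (deriv₂ j x y W)
        ⟨W, rfl⟩
      rw [inner_sub_left, sub_eq_zero] at h
      rw [h, ← hUT]
      exact hi.inner_deriv₂_deriv₂ x y z U W
  choose U hUnorm hUinner using hU
  refine ⟨f x₀, fun x ↦ ?_⟩
  have hsmul : f x ^ 2 • U x = f x₀ ^ 2 • U x₀ := by
    refine ext_inner_right ℝ fun W ↦ ?_
    rw [real_inner_smul_left, real_inner_smul_left, ← hUinner, ← hUinner]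
    exact hconst V W x x₀
  have hsq : f x ^ 2 = f x₀ ^ 2 := by
    have h := congrArg norm hsmul
    rw [norm_smul, norm_smul, hUnorm, hUnorm, Real.norm_of_nonneg (sq_nonneg _),
      Real.norm_of_nonneg (sq_nonneg _)] at h
    -- Properness of the slant angle enters here: `φ < π / 2` allows the division.
    have hcos : 0 < Real.cos φ :=
      Real.cos_pos_of_mem_Ioo ⟨by linarith [hφ.1, Real.pi_pos], hφ.2⟩
    exact mul_right_cancel₀ (mul_pos hcos hVpos).ne' h
  exact (sq_eq_sq₀ (hi.pos₁ x).le (hi.pos₁ x₀).le).1 hsq
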